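/- Let $k$ be an algebraically closed field of characteristic $0$ and let $\mathcal{C}$ be a fusion category over $k$: a $k$-linear abelian semisimple rigid tensor category (with $k$-bilinear tensor product) with finitely many isomorphism classes of simple objects, finite-dimensional spaces of morphisms, and simple unit object. Let $R=K_0(\mathcal{C})$ be its Grothendieck ring, i.e. the free $\mathbb{Z}$-module on the set $\{X_i\}$ of isomorphism classes of simple objects, with multiplication induced by the tensor product, and with the involution $X_i\mapsto X_i^*$ induced by duality. Here a based subring of $R$ is a unital subring which is the $\mathbb{Z}$-span of a $*$-stable subset of $\{X_i\}$, and based subbimodules are likewise spanned by subsets of $\{X_i\}$. Let $R_{ad}\subseteq R$ be the smallest based subring containing $X_iX_i^*$ for all $i$, and let $R=\bigoplus_{a\in G}R_a$ be the decomposition of $R$ into indecomposable based $R_{ad}$-subbimodules. The index set $G$ is a group, with $ab=c$ if and only if $R_aR_b\subseteq R_c$, with identity the component $R_{ad}$ and with $a^{-1}$ given by $R_{a^{-1}}=(R_a)^*$; it is called the universal grading group $U(\mathcal{C})$ of $\mathcal{C}$. Let $G_{ab}$ be the maximal abelian quotient of $G=U(\mathcal{C})$, let $\widehat{G_{ab}}=\mathrm{Hom}(G_{ab},k^\times)$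 be its group of characters, and let $\mathrm{Aut}_\otimes(\mathrm{id}_{\mathcal{C}})$ be the group of tensor (i.e. monoidal natural) automorphisms of the identity functor of $\mathcal{C}$. Then there is a group isomorphism $$\widehat{G_{ab}}\;\cong\;\mathrm{Aut}_\otimes(\mathrm{id}_{\mathcal{C}}).$$ -/

import Mathlib

open CategoryTheory CategoryTheory.Limits CategoryTheory.MonoidalCategory

/-! ## Based rings -/

/-- The symmetric `ℤ`-valued pairing on `R` for which the given basis is orthonormal. -/
noncomputable def basisPairing {ι R : Type*} [Ring R] (b : Module.Basis ι ℤ R) (x y : R) : ℤ :=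
  (b.repr x).sum fun i a => a * b.repr y i

/-- The additive extension to `R` of a self-map `i ↦ i^*` of the index set of a basis. -/
noncomputable def basisStar {ι R : Type*} [Ring R] (b : Module.Basis ι ℤ R) (σ : ι → ι) :
    R →ₗ[ℤ] R :=
  b.constr ℤ (fun i => b (σ i))

/-- A (unital) based ring, also called a fusion ring: a ring `R` of finite rank with a fixed
`ℤ₊`-basis `{X_i}`, one element of which is `1`, and an involution `i ↦ i^*` of the index set
such that `(x y, z) = (x, z y^*) = (y, x^* z)` for all `x, y, z`. -/
structure BasedRing (ι R : Type*) [Ring R] where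
  finite : Finite ι
  basis : Module.Basis ι ℤ R
  repr_mul_nonneg : ∀ i j l, 0 ≤ basis.repr (basis i * basis j) l
  unit : ι
  basis_unit : basis unit = 1
  dual : ι → ι
  dual_dual : ∀ i, dual (dual i) = i
  pairing_mul_left : ∀ x y z : R,
    basisPairing basis (x * y) z = basisPairing basis x (z * basisStar basis dual y)
  pairing_mul_right : ∀ x y z : R,
    basisPairing basis (x * y) z = basisPairing basis y (basisStar basis dual x * z)

namespace BasedRing

variable {ι R : Type*} [Ring R] (B : BasedRing ι R)

/-- The `ℤ`-submodule of `R` generated by a set of basic elements. -/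
def spanOf (D : Set ι) : Submodule ℤ R := Submodule.span ℤ (B.basis '' D)

/-- The set `D` of basic elements spans a based subring of `R`. -/
structure IsBasedSubring (D : Set ι) : Prop where
  one_mem : (1 : R) ∈ B.spanOf D
  mul_mem : ∀ x ∈ B.spanOf D, ∀ y ∈ B.spanOf D, x * y ∈ B.spanOf D
  dual_mem : ∀ i ∈ D, B.dual i ∈ D

/-- The basis of the adjoint subring `R_ad`, the smallest based subring of `R` that contains
`X_i X_i^*` for every `i`. -/
def adBasis : Set ι :=
  ⋂₀ {D | B.IsBasedSubring D ∧ ∀ i, B.basis i * B.basis (B.dual i) ∈ B.spanOf D}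

/-- The adjoint subring `R_ad`, as a `ℤ`-submodule of `R`. -/
def ad : Submodule ℤ R := B.spanOf B.adBasis

/-- The set `D` of basic elements spans a based `R_ad`-subbimodule of `R`. -/
def IsBasedSubbimodule (D : Set ι) : Prop :=
  ∀ r ∈ B.ad, ∀ m ∈ B.spanOf D, r * m ∈ B.spanOf D ∧ m * r ∈ B.spanOf D

/-- The set `D` of basic elements spans an indecomposable based `R_ad`-subbimodule of `R`:
it is non-zero and not the direct sum of two non-zero based subbimodules. -/
structure IsIndecomposable (D : Set ι) : Prop where
  nonempty : D.Nonempty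
  isBasedSubbimodule : B.IsBasedSubbimodule D
  eq_empty_or_eq_empty : ∀ D₁ D₂ : Set ι, B.IsBasedSubbimodule D₁ → B.IsBasedSubbimodule D₂ →
    D₁ ∪ D₂ = D → Disjoint D₁ D₂ → D₁ = ∅ ∨ D₂ = ∅

/-- The underlying set of the universal grading group `U(R)`: the set of indecomposable
components of `R` as a based `R_ad`-bimodule (each one given by its set of basic elements). -/
def UniversalGradingGroup : Type _ := {D : Set ι // B.IsIndecomposable D}

/-- The component `R_a` of the universal grading. -/
def component (a : B.UniversalGradingGroup) : Submodule ℤ R := B.spanOf a.1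

/-! ### Structure constants -/

/-- `X_l` is contained in `X_i X_j`. -/
def Cont (i j l : ι) : Prop := B.basis.repr (B.basis i * B.basis j) l ≠ 0

theorem mem_spanOf {D : Set ι} {x : R} :
    x ∈ B.spanOf D ↔ ∀ i, B.basis.repr x i ≠ 0 → i ∈ D := by
  rw [spanOf, Module.Basis.mem_span_image]
  constructor
  · intro h i hi
    exact h (by simpa using hi)
  · intro h i hi
    exact h i (by simpa using hi)

theorem basis_mem_spanOf {D : Set ι} {i : ι} (h : i ∈ D) : B.basis i ∈ B.spanOf D :=
  Submodule.subset_span ⟨i, h, rfl⟩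

theorem spanOf_mul {D E F : Set ι}
    (h : ∀ i ∈ D, ∀ j ∈ E, ∀ l, B.Cont i j l → l ∈ F) :
    ∀ x ∈ B.spanOf D, ∀ y ∈ B.spanOf E, x * y ∈ B.spanOf F := by
  intro x hx y hy
  have := Submodule.mul_mem_mul hx hy
  rw [spanOf, spanOf, Submodule.span_mul_span] at this
  refine (Submodule.span_le.2 ?_) this
  rintro _ ⟨_, ⟨i, hi, rfl⟩, _, ⟨j, hj, rfl⟩, rfl⟩
  exact B.mem_spanOf.2 fun l hl => h i hi j hj l hl

theorem repr_mul [Fintype ι] (x y : R) (l : ι) :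
    B.basis.repr (x * y) l = ∑ i, ∑ j, B.basis.repr x i * B.basis.repr y j *
      B.basis.repr (B.basis i * B.basis j) l := by
  conv_lhs => rw [← B.basis.sum_repr x, ← B.basis.sum_repr y]
  simp only [Finset.sum_mul, Finset.mul_sum, map_sum, Finsupp.coe_finsetSum, Finset.sum_apply,
    smul_mul_assoc, mul_smul_comm, map_smul, Finsupp.smul_apply, smul_eq_mul, mul_assoc]
  rw [Finset.sum_comm]
  refine Finset.sum_congr rfl fun i _ => Finset.sum_congr rfl fun j _ => ?_
  ring

theorem cont_assoc {i j l n : ι} :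
    (∃ m, B.Cont i j m ∧ B.Cont m l n) ↔ ∃ m, B.Cont j l m ∧ B.Cont i m n := by
  classical
  have := B.finite
  cases nonempty_fintype ι
  have h1 : B.basis.repr (B.basis i * B.basis j * B.basis l) n =
      ∑ m, B.basis.repr (B.basis i * B.basis j) m * B.basis.repr (B.basis m * B.basis l) n := by
    rw [repr_mul]
    simp [Finsupp.single_apply]
  have h2 : B.basis.repr (B.basis i * B.basis j * B.basis l) n =
      ∑ m, B.basis.repr (B.basis j * B.basis l) m * B.basis.repr (B.basis i * B.basis m) n := by
    rw [mul_assoc, repr_mul]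
    simp [Finsupp.single_apply]
  have e1 : (∃ m, B.Cont i j m ∧ B.Cont m l n) ↔
      B.basis.repr (B.basis i * B.basis j * B.basis l) n ≠ 0 := by
    rw [h1, Ne, Finset.sum_eq_zero_iff_of_nonneg
      (fun m _ => mul_nonneg (B.repr_mul_nonneg _ _ _) (B.repr_mul_nonneg _ _ _))]
    simp [Cont]
  have e2 : (∃ m, B.Cont j l m ∧ B.Cont i m n) ↔
      B.basis.repr (B.basis i * B.basis j * B.basis l) n ≠ 0 := by
    rw [h2, Ne, Finset.sum_eq_zero_iff_of_nonneg
      (fun m _ => mul_nonneg (B.repr_mul_nonneg _ _ _) (B.repr_mul_nonneg _ _ _))]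
    simp [Cont]
  rw [e1, e2]

theorem pairing_basis (x : R) (l : ι) : basisPairing B.basis x (B.basis l) = B.basis.repr x l := by
  classical
  have := B.finite
  cases nonempty_fintype ι
  simp [basisPairing, Finsupp.sum_fintype, Finsupp.single_apply]

theorem pairing_basis_left (x : R) (l : ι) :
    basisPairing B.basis (B.basis l) x = B.basis.repr x l := by
  simp [basisPairing]

theorem star_basis (i : ι) : basisStar B.basis B.dual (B.basis i) = B.basis (B.dual i) := by
  rw [basisStar, Module.Basis.constr_basis]

theorem cont_left {i j l : ι} : B.Cont i j l ↔ B.Cont l (B.dual j) i := by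
  have := B.pairing_mul_left (B.basis i) (B.basis j) (B.basis l)
  rw [pairing_basis, star_basis, pairing_basis_left] at this
  rw [Cont, Cont, this]

theorem cont_right {i j l : ι} : B.Cont i j l ↔ B.Cont (B.dual i) l j := by
  have := B.pairing_mul_right (B.basis i) (B.basis j) (B.basis l)
  rw [pairing_basis, star_basis, pairing_basis_left] at this
  rw [Cont, Cont, this]

theorem cont_dual {i j l : ι} : B.Cont i j l ↔ B.Cont (B.dual j) (B.dual i) (B.dual l) := by
  rw [cont_left, cont_right, cont_left]

theorem cont_unit_left {i j : ι} : B.Cont B.unit i j ↔ j = i := by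
  classical
  simp [Cont, basis_unit, Finsupp.single_apply, eq_comm]

theorem cont_unit_right {i j : ι} : B.Cont i B.unit j ↔ j = i := by
  classical
  simp [Cont, basis_unit, Finsupp.single_apply, eq_comm]

theorem cont_mul_dual (i : ι) : B.Cont i (B.dual i) B.unit :=
  B.cont_left.1 (B.cont_unit_left.2 rfl)

theorem cont_dual_mul (i : ι) : B.Cont (B.dual i) i B.unit := by
  have := B.cont_mul_dual (B.dual i)
  rwa [B.dual_dual] at this

theorem exists_cont (i j : ι) : ∃ l, B.Cont i j l := by
  obtain ⟨m, hm, -⟩ := (B.cont_assoc (i := B.dual i) (j := i) (l := j) (n := j)).1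
    ⟨B.unit, B.cont_dual_mul i, B.cont_unit_left.2 rfl⟩
  exact ⟨m, hm⟩

theorem dual_unit : B.dual B.unit = B.unit :=
  (B.cont_unit_left.1 (B.cont_mul_dual B.unit)).symm

/-! ### The linking relation -/

/-- `X_j` is contained in `X_p X_p^* X_i` for some `p`. -/
def Link (i j : ι) : Prop := ∃ p m, B.Cont p (B.dual p) m ∧ B.Cont m i j

theorem link_right {i j p m : ι} (h : B.Cont p (B.dual p) m) (h' : B.Cont i m j) : B.Link i j := by
  obtain ⟨q, hq, hq'⟩ := B.cont_assoc.2 ⟨m, h, h'⟩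
  obtain ⟨m', h1, h2⟩ := B.cont_assoc.2 ⟨B.dual p, B.cont_right.1 (B.cont_left.1 hq), hq'⟩
  exact ⟨q, m', h1, h2⟩

theorem link_right_iff {i j : ι} :
    B.Link i j ↔ ∃ p m, B.Cont p (B.dual p) m ∧ B.Cont i m j := by
  constructor
  · rintro ⟨p, m, h1, h2⟩
    obtain ⟨q, hq, hq'⟩ := B.cont_assoc.1 ⟨m, h1, h2⟩
    have hq1 : B.Cont p q i := by
      have := B.cont_right.1 hq
      rwa [B.dual_dual] at this
    have hq2 : B.Cont p (B.dual (B.dual q)) j := by rwa [B.dual_dual]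
    obtain ⟨m', h6, h7⟩ := B.cont_assoc.1 ⟨p, B.cont_left.1 hq1, hq2⟩
    exact ⟨_, m', h6, h7⟩
  · rintro ⟨p, m, h1, h2⟩
    exact B.link_right h1 h2

theorem link_refl (i : ι) : B.Link i i :=
  ⟨i, B.unit, B.cont_mul_dual i, B.cont_unit_left.2 rfl⟩

theorem cont_dual_self {p m : ι} (h : B.Cont p (B.dual p) m) : B.Cont p (B.dual p) (B.dual m) := by
  have := B.cont_dual.1 h
  rwa [B.dual_dual] at this

theorem link_symm {i j : ι} (h : B.Link i j) : B.Link j i := by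
  obtain ⟨p, m, h1, h2⟩ := h
  exact ⟨p, B.dual m, B.cont_dual_self h1, B.cont_right.1 h2⟩

/-- The equivalence relation generated by `Link`; its classes are the index sets of the
indecomposable based `R_ad`-subbimodules. -/
def Linked : ι → ι → Prop := Relation.ReflTransGen B.Link

theorem linked_symm {i j : ι} (h : B.Linked i j) : B.Linked j i := by
  induction h with
  | refl => exact .refl
  | tail _ h ih => exact .trans (.single (B.link_symm h)) ih

theorem linked_of_cont {i j k k' : ι} (h : B.Cont i j k) (h' : B.Cont i j k') : B.Linked k k' := by
  obtain ⟨m, h1, h2⟩ := B.cont_assoc.2 ⟨j, B.cont_right.1 h, h'⟩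
  exact .single ⟨i, m, h1, h2⟩

theorem linked_mul_left {i i' j k k' : ι} (hi : B.Linked i i')
    (h : B.Cont i j k) (h' : B.Cont i' j k') : B.Linked k k' := by
  induction hi generalizing k' with
  | refl => exact B.linked_of_cont h h'
  | @tail a b _ hl ih =>
    obtain ⟨p, m, h1, h2⟩ := hl
    obtain ⟨n, h3, h4⟩ := B.cont_assoc.1 ⟨b, h2, h'⟩
    exact (ih h3).trans (.single ⟨p, m, h1, h4⟩)

theorem linked_mul_right {i j j' k k' : ι} (hj : B.Linked j j')
    (h : B.Cont i j k) (h' : B.Cont i j' k') : B.Linked k k' := by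
  induction hj generalizing k' with
  | refl => exact B.linked_of_cont h h'
  | @tail a b _ hl ih =>
    obtain ⟨p, m, h1, h2⟩ := B.link_right_iff.1 hl
    obtain ⟨n, h3, h4⟩ := B.cont_assoc.2 ⟨b, h2, h'⟩
    exact (ih h3).trans (.single (B.link_right_iff.2 ⟨p, m, h1, h4⟩))

theorem linked_mul {i i' j j' k k' : ι} (hi : B.Linked i i') (hj : B.Linked j j')
    (h : B.Cont i j k) (h' : B.Cont i' j' k') : B.Linked k k' := by
  obtain ⟨n, hn⟩ := B.exists_cont i' j
  exact (B.linked_mul_left hi h hn).trans (B.linked_mul_right hj hn h')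

theorem linked_dual {i j : ι} (h : B.Linked i j) : B.Linked (B.dual i) (B.dual j) := by
  induction h with
  | refl => exact .refl
  | tail _ hl ih =>
    obtain ⟨p, m, h1, h2⟩ := hl
    exact ih.tail (B.link_right_iff.2 ⟨p, B.dual m, B.cont_dual_self h1, B.cont_dual.1 h2⟩)

/-! ### Components and linking classes -/

theorem mem_adBasis_of_cont {p m : ι} (h : B.Cont p (B.dual p) m) : m ∈ B.adBasis := by
  rintro D ⟨-, hD⟩
  exact B.mem_spanOf.1 (hD p) m h

theorem cont_mem_of_isBasedSubring {D : Set ι} (hD : B.IsBasedSubring D) {i j l : ι}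
    (hi : i ∈ D) (hj : j ∈ D) (h : B.Cont i j l) : l ∈ D :=
  B.mem_spanOf.1 (hD.mul_mem _ (B.basis_mem_spanOf hi) _ (B.basis_mem_spanOf hj)) l h

theorem unit_mem_of_isBasedSubring {D : Set ι} (hD : B.IsBasedSubring D) : B.unit ∈ D := by
  refine B.mem_spanOf.1 hD.one_mem B.unit ?_
  rw [← B.basis_unit]
  simp

theorem isBasedSubring_adBasis : B.IsBasedSubring B.adBasis where
  one_mem := by
    rw [← B.basis_unit]
    exact B.basis_mem_spanOf fun D hD => B.unit_mem_of_isBasedSubring hD.1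
  mul_mem := B.spanOf_mul fun i hi j hj l hl D hD =>
    B.cont_mem_of_isBasedSubring hD.1 (hi D hD) (hj D hD) hl
  dual_mem := fun i hi D hD => hD.1.dual_mem i (hi D hD)

theorem unit_mem_adBasis : B.unit ∈ B.adBasis :=
  B.unit_mem_of_isBasedSubring B.isBasedSubring_adBasis

theorem isBasedSubbimodule_iff {D : Set ι} : B.IsBasedSubbimodule D ↔
    ∀ a ∈ B.adBasis, ∀ d ∈ D, ∀ l, (B.Cont a d l → l ∈ D) ∧ (B.Cont d a l → l ∈ D) := by
  constructor
  · intro h a ha d hd l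
    obtain ⟨h1, h2⟩ := h _ (B.basis_mem_spanOf ha) _ (B.basis_mem_spanOf hd)
    exact ⟨B.mem_spanOf.1 h1 l, B.mem_spanOf.1 h2 l⟩
  · intro h r hr m hm
    exact ⟨B.spanOf_mul (fun i hi j hj l => (h i hi j hj l).1) r hr m hm,
      B.spanOf_mul (fun i hi j hj l => (h j hj i hi l).2) m hm r hr⟩

theorem isBasedSubbimodule_of_link {D : Set ι} (hD : ∀ i ∈ D, ∀ j, B.Link i j → j ∈ D) :
    B.IsBasedSubbimodule D := by
  have hD' : ∀ i j, B.Link i j → (i ∈ D ↔ j ∈ D) := fun i j h =>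
    ⟨fun hi => hD i hi j h, fun hj => hD j hj i (B.link_symm h)⟩
  let S : Set ι := {a | ∀ d l, (B.Cont a d l → (d ∈ D ↔ l ∈ D)) ∧ (B.Cont d a l → (d ∈ D ↔ l ∈ D))}
  have hS : B.IsBasedSubring S := by
    refine ⟨?_, ?_, ?_⟩
    · rw [← B.basis_unit]
      refine B.basis_mem_spanOf fun d l => ⟨fun h => ?_, fun h => ?_⟩
      · rw [B.cont_unit_left.1 h]
      · rw [B.cont_unit_right.1 h]
    · refine B.spanOf_mul fun i hi j hj m hm d l => ⟨fun h => ?_, fun h => ?_⟩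
      · obtain ⟨n, h1, h2⟩ := B.cont_assoc.1 ⟨m, hm, h⟩
        exact ((hj d n).1 h1).trans ((hi n l).1 h2)
      · obtain ⟨n, h1, h2⟩ := B.cont_assoc.2 ⟨m, hm, h⟩
        exact ((hi d n).2 h1).trans ((hj n l).2 h2)
    · intro i hi d l
      refine ⟨fun h => ?_, fun h => ?_⟩
      · have := B.cont_right.1 h
        rw [B.dual_dual] at this
        exact ((hi l d).1 this).symm
      · have := B.cont_left.1 h
        rw [B.dual_dual] at this
        exact ((hi l d).2 this).symm
  have hadS : B.adBasis ⊆ S := by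
    refine Set.sInter_subset_of_mem ⟨hS, fun p => B.mem_spanOf.2 fun m hm d l => ⟨fun h => ?_,
      fun h => ?_⟩⟩
    · exact hD' d l ⟨p, m, hm, h⟩
    · exact hD' d l (B.link_right hm h)
  rw [isBasedSubbimodule_iff]
  intro a ha d hd l
  exact ⟨fun h => ((hadS ha d l).1 h).1 hd, fun h => ((hadS ha d l).2 h).1 hd⟩

theorem mem_of_linked {D : Set ι} (hD : B.IsBasedSubbimodule D) {i j : ι} (hi : i ∈ D)
    (h : B.Linked i j) : j ∈ D := by
  induction h with
  | refl => exact hi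
  | tail _ hl ih =>
    obtain ⟨p, m, h1, h2⟩ := hl
    exact ((B.isBasedSubbimodule_iff.1 hD) m (B.mem_adBasis_of_cont h1) _ ih _).1 h2

theorem isIndecomposable_class (i : ι) : B.IsIndecomposable {j | B.Linked i j} where
  nonempty := ⟨i, .refl⟩
  isBasedSubbimodule := B.isBasedSubbimodule_of_link fun _ hj _ h => hj.tail h
  eq_empty_or_eq_empty := by
    intro D₁ D₂ h1 h2 hu hd
    have key : ∀ E F : Set ι, B.IsBasedSubbimodule E → E ∪ F = {j | B.Linked i j} →
        Disjoint E F → i ∈ E → F = ∅ := by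
      intro E F hE hEF hdis hi
      refine Set.eq_empty_of_forall_notMem fun x hx => ?_
      have hx' : x ∈ {j | B.Linked i j} := hEF ▸ Or.inr hx
      exact Set.disjoint_left.1 hdis (B.mem_of_linked hE hi hx') hx
    have hi : i ∈ D₁ ∪ D₂ := by
      rw [hu]
      exact Relation.ReflTransGen.refl
    rcases hi with hi | hi
    · exact Or.inr (key D₁ D₂ h1 hu hd hi)
    · exact Or.inl (key D₂ D₁ h2 (by rw [Set.union_comm, hu]) hd.symm hi)

theorem IsIndecomposable.mem_iff {D : Set ι} (hD : B.IsIndecomposable D) {i j : ι} (hi : i ∈ D) :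
    j ∈ D ↔ B.Linked i j := by
  refine ⟨fun hj => ?_, B.mem_of_linked hD.isBasedSubbimodule hi⟩
  by_contra hij
  have hsub : {j | B.Linked i j} ⊆ D := fun x hx => B.mem_of_linked hD.isBasedSubbimodule hi hx
  have h2 : B.IsBasedSubbimodule (D \ {j | B.Linked i j}) :=
    B.isBasedSubbimodule_of_link fun x hx y hxy =>
      ⟨B.mem_of_linked hD.isBasedSubbimodule hx.1 (.single hxy),
        fun hy => hx.2 (hy.tail (B.link_symm hxy))⟩
  rcases hD.eq_empty_or_eq_empty _ _ (B.isIndecomposable_class i).isBasedSubbimodule h2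
    (Set.union_sdiff_cancel hsub) Set.disjoint_sdiff_right with h | h
  · exact (B.isIndecomposable_class i).nonempty.ne_empty h
  · exact Set.notMem_empty j (h ▸ ⟨hj, hij⟩)

/-! ### The group structure -/

/-- The component to which `X_i` belongs. -/
def comp (i : ι) : B.UniversalGradingGroup := ⟨_, B.isIndecomposable_class i⟩

theorem comp_eq_iff {i : ι} {a : B.UniversalGradingGroup} : B.comp i = a ↔ i ∈ a.1 := by
  constructor
  · rintro rfl
    exact Relation.ReflTransGen.refl
  · intro h
    refine Subtype.ext (Set.ext fun j => ?_)
    exact (IsIndecomposable.mem_iff B a.2 h).symm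

theorem comp_eq_comp {i j : ι} : B.comp i = B.comp j ↔ B.Linked j i := by
  rw [comp_eq_iff]
  rfl

theorem exists_comp (a : B.UniversalGradingGroup) : ∃ i, B.comp i = a :=
  let ⟨i, hi⟩ := a.2.nonempty
  ⟨i, B.comp_eq_iff.2 hi⟩

theorem mul_le_component_iff {a b c : B.UniversalGradingGroup} :
    (∀ x ∈ B.component a, ∀ y ∈ B.component b, x * y ∈ B.component c) ↔
      ∀ i j l, B.comp i = a → B.comp j = b → B.Cont i j l → B.comp l = c := by
  simp only [comp_eq_iff]
  constructor
  · intro h i j l hi hj hl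
    exact B.mem_spanOf.1 (h _ (B.basis_mem_spanOf hi) _ (B.basis_mem_spanOf hj)) l hl
  · intro h
    exact B.spanOf_mul fun i hi j hj l hl => h i j l hi hj hl

/-- For components `R_a`, `R_b` there is a unique component `R_c` with `R_a R_b ⊆ R_c`. -/
theorem existsUnique_mul (a b : B.UniversalGradingGroup) : ∃! c : B.UniversalGradingGroup,
    ∀ x ∈ B.component a, ∀ y ∈ B.component b, x * y ∈ B.component c := by
  obtain ⟨i, rfl⟩ := B.exists_comp a
  obtain ⟨j, rfl⟩ := B.exists_comp b
  obtain ⟨l, hl⟩ := B.exists_cont i j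
  refine ⟨B.comp l, B.mul_le_component_iff.2 fun i' j' l' hi hj h => ?_, fun c hc => ?_⟩
  · rw [comp_eq_comp] at hi hj ⊢
    exact B.linked_mul hi hj hl h
  · exact (B.mul_le_component_iff.1 hc i j l rfl rfl hl).symm

/-- The identity of `U(R)` is the component `R_ad`. -/
instance : One B.UniversalGradingGroup where
  one := ⟨B.adBasis, by
    have h : B.IsBasedSubbimodule B.adBasis := fun r hr m hm =>
      ⟨B.isBasedSubring_adBasis.mul_mem r hr m hm, B.isBasedSubring_adBasis.mul_mem m hm r hr⟩
    have : B.adBasis = {j | B.Linked B.unit j} := by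
      refine Set.Subset.antisymm (fun a ha => ?_)
        (fun a ha => B.mem_of_linked h B.unit_mem_adBasis ha)
      exact ((B.isBasedSubbimodule_iff.1 (B.isIndecomposable_class B.unit).isBasedSubbimodule)
        a ha B.unit Relation.ReflTransGen.refl a).1 (B.cont_unit_right.2 rfl)
    rw [this]
    exact B.isIndecomposable_class B.unit⟩

/-- The product `a b` in `U(R)` is the unique `c` with `R_a R_b ⊆ R_c`. -/
noncomputable instance : Mul B.UniversalGradingGroup where
  mul a b := (B.existsUnique_mul a b).choose

/-- The inverse of `a` in `U(R)` is the component `(R_a)^*`. -/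
instance : Inv B.UniversalGradingGroup where
  inv a := ⟨B.dual '' a.1, by
    obtain ⟨i, hi⟩ := B.exists_comp a
    have : B.dual '' a.1 = {j | B.Linked (B.dual i) j} := by
      subst hi
      ext j
      constructor
      · rintro ⟨k, hk, rfl⟩
        exact B.linked_dual hk
      · intro hj
        refine ⟨B.dual j, ?_, B.dual_dual j⟩
        have := B.linked_dual hj
        rwa [B.dual_dual] at this
    rw [this]
    exact B.isIndecomposable_class _⟩

theorem mul_eq_iff {a b c : B.UniversalGradingGroup} :
    a * b = c ↔ ∀ x ∈ B.component a, ∀ y ∈ B.component b, x * y ∈ B.component c := by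
  have h := (B.existsUnique_mul a b).choose_spec
  refine ⟨?_, fun hc => (h.2 c hc).symm⟩
  rintro rfl
  exact h.1

theorem comp_mul_comp {i j l : ι} (h : B.Cont i j l) : B.comp i * B.comp j = B.comp l :=
  (B.mul_le_component_iff.1 (B.mul_eq_iff.1 rfl) i j l rfl rfl h).symm

theorem comp_unit : B.comp B.unit = 1 := B.comp_eq_iff.2 B.unit_mem_adBasis

theorem comp_dual (i : ι) : B.comp (B.dual i) = (B.comp i)⁻¹ :=
  B.comp_eq_iff.2 ⟨i, Relation.ReflTransGen.refl, rfl⟩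

noncomputable instance : Group B.UniversalGradingGroup :=
  Group.ofLeftAxioms
    (by
      intro a b c
      obtain ⟨i, rfl⟩ := B.exists_comp a
      obtain ⟨j, rfl⟩ := B.exists_comp b
      obtain ⟨l, rfl⟩ := B.exists_comp c
      obtain ⟨m, hm⟩ := B.exists_cont i j
      obtain ⟨n, hn⟩ := B.exists_cont m l
      obtain ⟨m', h1, h2⟩ := B.cont_assoc.1 ⟨m, hm, hn⟩
      rw [B.comp_mul_comp hm, B.comp_mul_comp hn, B.comp_mul_comp h1, B.comp_mul_comp h2])
    (by
      intro a
      obtain ⟨i, rfl⟩ := B.exists_comp a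
      rw [← comp_unit, B.comp_mul_comp (B.cont_unit_left.2 rfl)])
    (by
      intro a
      obtain ⟨i, rfl⟩ := B.exists_comp a
      rw [← comp_dual, B.comp_mul_comp (B.cont_dual_mul i), comp_unit])

end BasedRing

/-! ## Fusion categories -/

section FusionCategory

set_option linter.unusedSectionVars false
set_option linter.unusedSimpArgs false

attribute [local instance] Abelian.hasFiniteBiproducts

/-- Isomorphism of simple objects. -/
def simpleSetoid (C : Type*) [Category* C] [HasZeroMorphisms C] : Setoid {X : C // Simple X} where
  r X Y := Nonempty (X.1 ≅ Y.1)
  iseqv := ⟨fun _ => ⟨Iso.refl _⟩, fun ⟨e⟩ => ⟨e.symm⟩, fun ⟨e⟩ ⟨f⟩ => ⟨e ≪≫ f⟩⟩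

/-- The set of isomorphism classes of simple objects of `C`. -/
def SimpleClass (C : Type*) [Category* C] [HasZeroMorphisms C] : Type _ :=
  Quotient (simpleSetoid C)

namespace SimpleClass

section

variable {C : Type*} [Category* C] [HasZeroMorphisms C]

/-- The isomorphism class of a simple object. -/
def of (X : C) [h : Simple X] : SimpleClass C := Quotient.mk (simpleSetoid C) ⟨X, h⟩

/-- A simple object representing an isomorphism class. -/
noncomputable def rep (i : SimpleClass C) : C := (Quotient.out i).1

instance (i : SimpleClass C) : Simple i.rep := (Quotient.out i).2

theorem of_eq_iff {X Y : C} [Simple X] [Simple Y] : of X = of Y ↔ Nonempty (X ≅ Y) :=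
  Quotient.eq

theorem of_rep (i : SimpleClass C) : of i.rep = i := Quotient.out_eq i

theorem rep_of (X : C) [Simple X] : Nonempty ((of X).rep ≅ X) := by
  rw [← of_eq_iff, of_rep]

theorem rep_iso_iff {i j : SimpleClass C} : Nonempty (i.rep ≅ j.rep) ↔ i = j := by
  rw [← of_eq_iff, of_rep, of_rep]

end

end SimpleClass

/-- A fusion category over `k`: a `k`-linear abelian rigid tensor category with bilinear tensor
product which is semisimple (every object is a finite direct sum of simple objects), has finitely
many isomorphism classes of simple objects, finite dimensional spaces of morphisms, and a simple
unit object. -/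
class IsFusionCategory (k : Type*) [Field k] (C : Type*) [Category* C] [Abelian C] [Linear k C]
    [MonoidalCategory C] [MonoidalPreadditive C] [MonoidalLinear k C] [RigidCategory C] :
    Prop where
  semisimple : ∀ X : C, ∃ (n : ℕ) (S : Fin n → C), (∀ i, Simple (S i)) ∧ Nonempty (X ≅ ⨁ S)
  finite_simpleClass : Finite (SimpleClass C)
  finiteDimensional_hom : ∀ X Y : C, FiniteDimensional k (X ⟶ Y)
  simple_unit : Simple (𝟙_ C)

/-- The underlying group of the Grothendieck ring `K₀(C)`: the free `ℤ`-module on the isomorphism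
classes of simple objects. -/
def K0 (k : Type*) [Field k] (C : Type*) [Category* C] [Abelian C] [Linear k C] : Type _ :=
  SimpleClass C →₀ ℤ

namespace K0

noncomputable instance (k : Type*) [Field k] (C : Type*) [Category* C] [Abelian C] [Linear k C] :
    AddCommGroup (K0 k C) := inferInstanceAs (AddCommGroup (SimpleClass C →₀ ℤ))

section

variable (k : Type*) [Field k] {C : Type*} [Category* C] [Abelian C] [Linear k C]

/-- The basis of `K₀(C)` formed by the classes of the simple objects. -/
noncomputable def basis : Module.Basis (SimpleClass C) ℤ (K0 k C) :=
  Module.Basis.ofRepr (LinearEquiv.refl ℤ (SimpleClass C →₀ ℤ))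

theorem basis_induction {P : K0 k C → Prop} (add : ∀ x y, P x → P y → P (x + y))
    (smul : ∀ (n : ℤ) x, P x → P (n • x)) (basis : ∀ i, P (basis k i)) (zero : P 0) (x : K0 k C) :
    P x := by
  have hx : x ∈ Submodule.span ℤ (Set.range (K0.basis k (C := C))) := by
    rw [Module.Basis.span_eq]
    trivial
  induction hx using Submodule.span_induction with
  | mem x h =>
    obtain ⟨i, rfl⟩ := h
    exact basis i
  | zero => exact zero
  | add x y _ _ hx hy => exact add x y hx hy
  | smul n x _ hx => exact smul n x hx

variable [MonoidalCategory C] [MonoidalPreadditive C] [MonoidalLinear k C] [RigidCategory C]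
  [hC : IsFusionCategory k C]

/-- The class in `K₀(C)` of an object `M`. The multiplicity in `M` of the simple object `X` is
`dim Hom(X, M)`. -/
noncomputable def cls (M : C) : K0 k C :=
  haveI := hC.finite_simpleClass
  Finsupp.equivFunOnFinite.symm fun i : SimpleClass C => (Module.finrank k (i.rep ⟶ M) : ℤ)

/-- The multiplication of `K₀(C)`, the bilinear map with `[X] [Y] = [X ⊗ Y]` for simple objects
`X` and `Y`. -/
noncomputable def mulHom : K0 k C →ₗ[ℤ] K0 k C →ₗ[ℤ] K0 k C :=
  (basis k).constr ℤ fun i => (basis k).constr ℤ fun j => cls k (i.rep ⊗ j.rep)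

theorem basis_repr_cls (M : C) (i : SimpleClass C) :
    (basis k).repr (cls k M) i = (Module.finrank k (i.rep ⟶ M) : ℤ) := rfl

theorem cls_eq_iff {M N : C} : cls k M = cls k N ↔
    ∀ i : SimpleClass C, Module.finrank k (i.rep ⟶ M) = Module.finrank k (i.rep ⟶ N) := by
  rw [← (basis k).repr.injective.eq_iff, Finsupp.ext_iff]
  simp only [basis_repr_cls, Nat.cast_inj]

theorem cls_iso {M N : C} (e : M ≅ N) : cls k M = cls k N :=
  (cls_eq_iff k).2 fun _ => (Linear.homCongr k (Iso.refl _) e).finrank_eq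

end

section

variable (k : Type*) [Field k] {C : Type*} [Category* C] [Abelian C] [Linear k C]

/-- `Hom(Z, -)` turns finite direct sums into products. -/
noncomputable def homBiproduct (Z : C) {n : ℕ} (S : Fin n → C) :
    (Z ⟶ ⨁ S) ≃ₗ[k] ∀ j, (Z ⟶ S j) where
  toFun f j := f ≫ biproduct.π S j
  invFun f := biproduct.lift f
  map_add' f g := by ext j; simp
  map_smul' c f := by ext j; simp
  left_inv f := by ext j; simp
  right_inv f := by ext j; simp

/-- `Hom(-, Z)` turns finite direct sums into products. -/
noncomputable def biproductHom (Z : C) {n : ℕ} (S : Fin n → C) :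
    (⨁ S ⟶ Z) ≃ₗ[k] ∀ j, (S j ⟶ Z) where
  toFun f j := biproduct.ι S j ≫ f
  invFun f := biproduct.desc f
  map_add' f g := by ext j; simp
  map_smul' c f := by ext j; simp
  left_inv f := by ext j; simp
  right_inv f := by ext j; simp

variable [MonoidalCategory C] [MonoidalPreadditive C] [MonoidalLinear k C]

/-- The duality isomorphism `Hom(X^* ⊗ A, Z) ≃ Hom(A, X ⊗ Z)`. -/
noncomputable def homDualLeft (A X Z : C) [HasRightDual X] :
    (Xᘁ ⊗ A ⟶ Z) ≃ₗ[k] (A ⟶ X ⊗ Z) where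
  __ := tensorLeftHomEquiv A X Xᘁ Z
  map_add' f g := by simp [tensorLeftHomEquiv]
  map_smul' c f := by simp [tensorLeftHomEquiv]

/-- The duality isomorphism `Hom(A ⊗ X, Z) ≃ Hom(A, Z ⊗ X^*)`. -/
noncomputable def homDualRight (A X Z : C) [HasRightDual X] :
    (A ⊗ X ⟶ Z) ≃ₗ[k] (A ⟶ Z ⊗ Xᘁ) where
  __ := tensorRightHomEquiv A X Xᘁ Z
  map_add' f g := by simp [tensorRightHomEquiv]
  map_smul' c f := by simp [tensorRightHomEquiv]

end

section

variable (k : Type*) [Field k] [IsAlgClosed k] {C : Type*} [Category* C] [Abelian C] [Linear k C]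
  [MonoidalCategory C] [MonoidalPreadditive C] [MonoidalLinear k C] [RigidCategory C]
  [hC : IsFusionCategory k C]

theorem finrank_hom_biproduct (Z : C) {n : ℕ} (S : Fin n → C) :
    Module.finrank k (Z ⟶ ⨁ S) = ∑ j, Module.finrank k (Z ⟶ S j) := by
  have := hC.finiteDimensional_hom
  rw [(homBiproduct k Z S).finrank_eq, Module.finrank_pi_fintype]

theorem finrank_biproduct_hom (Z : C) {n : ℕ} (S : Fin n → C) :
    Module.finrank k (⨁ S ⟶ Z) = ∑ j, Module.finrank k (S j ⟶ Z) := by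
  have := hC.finiteDimensional_hom
  rw [(biproductHom k Z S).finrank_eq, Module.finrank_pi_fintype]

theorem finrank_hom_comm_of_simple (X Y : C) [Simple X] [Simple Y] :
    Module.finrank k (X ⟶ Y) = Module.finrank k (Y ⟶ X) := by
  have := hC.finiteDimensional_hom
  rw [finrank_hom_simple_simple, finrank_hom_simple_simple]
  congr 1
  exact propext ⟨fun ⟨e⟩ => ⟨e.symm⟩, fun ⟨e⟩ => ⟨e.symm⟩⟩

theorem finrank_hom_comm (X M : C) [Simple X] :
    Module.finrank k (X ⟶ M) = Module.finrank k (M ⟶ X) := by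
  obtain ⟨n, S, hS, ⟨e⟩⟩ := hC.semisimple M
  rw [(Linear.homCongr k (Iso.refl X) e).finrank_eq, (Linear.homCongr k e (Iso.refl X)).finrank_eq,
    finrank_hom_biproduct, finrank_biproduct_hom]
  exact Finset.sum_congr rfl fun j _ => have := hS j; finrank_hom_comm_of_simple k X (S j)

theorem simple_of_finrank_end {M : C} (h : Module.finrank k (M ⟶ M) = 1) : Simple M := by
  have := hC.finiteDimensional_hom
  obtain ⟨n, S, hS, ⟨e⟩⟩ := hC.semisimple M
  rw [(Linear.homCongr k e e).finrank_eq, finrank_hom_biproduct] at h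
  simp only [finrank_biproduct_hom] at h
  have h1 : ∀ j, 1 ≤ ∑ i, Module.finrank k (S i ⟶ S j) := fun j =>
    have := hS j
    (finrank_endomorphism_simple_eq_one k (S j)).symm.le.trans
      (Finset.single_le_sum (f := fun i => Module.finrank k (S i ⟶ S j))
        (fun _ _ => Nat.zero_le _) (Finset.mem_univ j))
  have h2 : n ≤ 1 := by
    calc n = ∑ j : Fin n, 1 := by simp
      _ ≤ ∑ j, ∑ i, Module.finrank k (S i ⟶ S j) := Finset.sum_le_sum fun j _ => h1 j
      _ = 1 := h
  have h3 : n ≠ 0 := by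
    rintro rfl
    simp at h
  obtain rfl : n = 1 := by omega
  have := hS 0
  have e' : ⨁ S ≅ S 0 := biproductUniqueIso S
  exact Simple.of_iso (e ≪≫ e')

theorem finrank_end (X : C) [Simple X] : Module.finrank k (X ⟶ X) = 1 := by
  have := hC.finiteDimensional_hom
  exact finrank_endomorphism_simple_eq_one k X

theorem cls_rep (i : SimpleClass C) : cls k i.rep = basis k i := by
  classical
  have := hC.finiteDimensional_hom
  refine (basis k).repr.injective (Finsupp.ext fun j => ?_)
  rw [basis_repr_cls, Module.Basis.repr_self, finrank_hom_simple_simple, Finsupp.single_apply]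
  simp only [SimpleClass.rep_iso_iff, eq_comm (a := i)]
  split_ifs <;> rfl

theorem cls_biproduct {n : ℕ} (S : Fin n → C) : cls k (⨁ S) = ∑ j, cls k (S j) := by
  refine (basis k).repr.injective (Finsupp.ext fun i => ?_)
  rw [basis_repr_cls, finrank_hom_biproduct, map_sum, Finsupp.finsetSum_apply]
  simp only [basis_repr_cls, Nat.cast_sum]

theorem cls_simple (X : C) [Simple X] : cls k X = basis k (SimpleClass.of X) := by
  obtain ⟨e⟩ := SimpleClass.rep_of X
  rw [← cls_rep, cls_iso k e]

theorem mulHom_basis (i j : SimpleClass C) :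
    mulHom k (basis k i) (basis k j) = cls k (i.rep ⊗ j.rep) := by
  rw [mulHom, Module.Basis.constr_basis, Module.Basis.constr_basis]

/-- The class of a tensor product is the product of the classes, for arbitrary objects. -/
theorem cls_tensor (M N : C) : cls k (M ⊗ N) = mulHom k (cls k M) (cls k N) := by
  have key1 : ∀ X Y : C, Simple X → Simple Y →
      cls k (X ⊗ Y) = mulHom k (cls k X) (cls k Y) := by
    intro X Y hX hY
    obtain ⟨e⟩ := SimpleClass.rep_of X
    obtain ⟨f⟩ := SimpleClass.rep_of Y
    rw [cls_simple k X, cls_simple k Y, mulHom_basis]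
    exact cls_iso k (e.symm ⊗ᵢ f.symm)
  have key2 : ∀ X : C, Simple X → cls k (X ⊗ N) = mulHom k (cls k X) (cls k N) := by
    intro X hX
    obtain ⟨n, S, hS, ⟨e⟩⟩ := hC.semisimple N
    rw [cls_iso k e, cls_iso k (whiskerLeftIso X e ≪≫ leftDistributor X S), cls_biproduct,
      cls_biproduct, map_sum]
    exact Finset.sum_congr rfl fun j _ => key1 X (S j) hX (hS j)
  obtain ⟨n, S, hS, ⟨e⟩⟩ := hC.semisimple M
  rw [cls_iso k e, cls_iso k (whiskerRightIso e N ≪≫ rightDistributor S N), cls_biproduct,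
    cls_biproduct, map_sum, LinearMap.sum_apply]
  exact Finset.sum_congr rfl fun j _ => key2 (S j) (hS j)

theorem mulHom_assoc (x y z : K0 k C) :
    mulHom k (mulHom k x y) z = mulHom k x (mulHom k y z) := by
  induction x using basis_induction k with
  | zero => simp
  | add x x' hx hx' => simp only [map_add, LinearMap.add_apply, hx, hx']
  | smul n x hx => simp only [map_smul, LinearMap.smul_apply, hx]
  | basis i =>
  induction y using basis_induction k with
  | zero => simp
  | add x x' hx hx' => simp only [map_add, LinearMap.add_apply, hx, hx']
  | smul n x hx => simp only [map_smul, LinearMap.smul_apply, hx]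
  | basis j =>
  induction z using basis_induction k with
  | zero => simp
  | add x x' hx hx' => simp only [map_add, hx, hx']
  | smul n x hx => simp only [map_smul, hx]
  | basis l =>
  simp only [← cls_rep, ← cls_tensor]
  exact cls_iso k (α_ _ _ _)

theorem one_mulHom (x : K0 k C) : mulHom k (cls k (𝟙_ C)) x = x := by
  induction x using basis_induction k with
  | zero => simp
  | add x x' hx hx' => simp only [map_add, hx, hx']
  | smul n x hx => simp only [map_smul, hx]
  | basis i =>
  rw [← cls_rep, ← cls_tensor]
  exact cls_iso k (λ_ _)

theorem mulHom_one (x : K0 k C) : mulHom k x (cls k (𝟙_ C)) = x := by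
  induction x using basis_induction k with
  | zero => simp
  | add x x' hx hx' => simp only [map_add, LinearMap.add_apply, hx, hx']
  | smul n x hx => simp only [map_smul, LinearMap.smul_apply, hx]
  | basis i =>
  rw [← cls_rep, ← cls_tensor]
  exact cls_iso k (ρ_ _)

/-- The Grothendieck ring `K₀(C)`. -/
noncomputable instance : Ring (K0 k C) where
  __ := (inferInstance : AddCommGroup (K0 k C))
  mul x y := mulHom k x y
  one := cls k (𝟙_ C)
  left_distrib x y z := map_add (mulHom k x) y z
  right_distrib x y z := by
    change mulHom k (x + y) z = mulHom k x z + mulHom k y z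
    rw [map_add, LinearMap.add_apply]
  zero_mul x := by
    change mulHom k 0 x = 0
    rw [map_zero, LinearMap.zero_apply]
  mul_zero x := map_zero (mulHom k x)
  mul_assoc := mulHom_assoc k
  one_mul := one_mulHom k
  mul_one := mulHom_one k

theorem mul_def (x y : K0 k C) : x * y = mulHom k x y := rfl

theorem one_def : (1 : K0 k C) = cls k (𝟙_ C) := rfl

theorem basis_mul_basis (i j : SimpleClass C) :
    basis k i * basis k j = cls k (i.rep ⊗ j.rep) := mulHom_basis k i j

/-! ### Duality -/

end

section

variable (k : Type*) [Field k] [IsAlgClosed k] {C : Type*} [Category* C] [Abelian C] [Linear k C]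
  [MonoidalCategory C] [MonoidalPreadditive C] [MonoidalLinear k C] [RigidCategory C]

theorem simple_dual (hC : IsFusionCategory k C) (X : C) [Simple X] : Simple (Xᘁ) := by
  refine simple_of_finrank_end k ?_
  rw [← finrank_end k X, ← (Linear.homCongr k (ρ_ (Xᘁ)) (Iso.refl (Xᘁ))).finrank_eq,
    (homDualLeft k (𝟙_ C) X (Xᘁ)).finrank_eq, ← (homDualRight k (𝟙_ C) X X).finrank_eq,
    (Linear.homCongr k (λ_ X) (Iso.refl X)).finrank_eq]

theorem dual_dual_iso (hC : IsFusionCategory k C) (X : C) [Simple X] : Nonempty (X ≅ HasRightDual.rightDual (Xᘁ)) := by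
  have := hC.simple_unit
  have := hC.finiteDimensional_hom
  have := simple_dual k hC X
  have := simple_dual k hC (Xᘁ)
  rw [← finrank_hom_simple_simple_eq_one_iff k,
    ← (Linear.homCongr k (Iso.refl X) (λ_ (HasRightDual.rightDual (Xᘁ)))).finrank_eq,
    ← (homDualRight k X (Xᘁ) (𝟙_ C)).finrank_eq, ← finrank_hom_comm,
    ← (homDualRight k (𝟙_ C) X X).finrank_eq,
    (Linear.homCongr k (λ_ X) (Iso.refl X)).finrank_eq, finrank_end]

end

section

variable (k : Type*) [Field k] [IsAlgClosed k] {C : Type*} [Category* C] [Abelian C] [Linear k C]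
  [MonoidalCategory C] [MonoidalPreadditive C] [MonoidalLinear k C] [RigidCategory C]
  [hC : IsFusionCategory k C]

/-- The involution `X ↦ X^*` on isomorphism classes of simple objects. -/
noncomputable def dual (i : SimpleClass C) : SimpleClass C :=
  haveI := simple_dual k hC i.rep
  SimpleClass.of (i.repᘁ)

theorem rep_dual (i : SimpleClass C) : Nonempty ((dual k i).rep ≅ i.repᘁ) :=
  haveI := simple_dual k hC i.rep
  SimpleClass.rep_of _

theorem dual_dual (i : SimpleClass C) : dual k (dual k i) = i := by
  obtain ⟨e⟩ := rep_dual k i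
  obtain ⟨f⟩ := rep_dual k (dual k i)
  obtain ⟨g⟩ := dual_dual_iso k hC i.rep
  let e' : HasRightDual.rightDual (dual k i).rep ≅ HasRightDual.rightDual (i.repᘁ) :=
    rightDualIso inferInstance (exactPairingCongrLeft e)
  exact SimpleClass.rep_iso_iff.1 ⟨f ≪≫ e' ≪≫ g.symm⟩

theorem repr_mul_eq_left (i j l : SimpleClass C) :
    (basis k).repr (basis k i * basis k j) l = (basis k).repr (basis k l * basis k (dual k j)) i := by
  obtain ⟨e⟩ := rep_dual k j
  rw [basis_mul_basis, basis_mul_basis, basis_repr_cls, basis_repr_cls,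
    (Linear.homCongr k (Iso.refl i.rep) (whiskerLeftIso l.rep e)).finrank_eq,
    ← (homDualRight k i.rep j.rep l.rep).finrank_eq, finrank_hom_comm]

theorem repr_mul_eq_right (i j l : SimpleClass C) :
    (basis k).repr (basis k i * basis k j) l = (basis k).repr (basis k (dual k i) * basis k l) j := by
  obtain ⟨e⟩ := rep_dual k i
  rw [basis_mul_basis, basis_mul_basis, basis_repr_cls, basis_repr_cls,
    (Linear.homCongr k (Iso.refl j.rep) (whiskerRightIso e l.rep)).finrank_eq,
    finrank_hom_comm k j.rep, (homDualLeft k l.rep i.rep j.rep).finrank_eq]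

theorem pairing_add_left (x x' y : K0 k C) : basisPairing (basis k) (x + x') y =
    basisPairing (basis k) x y + basisPairing (basis k) x' y := by
  rw [basisPairing, map_add, Finsupp.sum_add_index' (by simp) (by intros; ring)]
  rfl

theorem pairing_smul_left (n : ℤ) (x y : K0 k C) : basisPairing (basis k) (n • x) y =
    n * basisPairing (basis k) x y := by
  rw [basisPairing, map_smul, Finsupp.sum_smul_index (by simp), basisPairing, Finsupp.mul_sum]
  simp only [mul_assoc]

theorem pairing_add_right (x y y' : K0 k C) : basisPairing (basis k) x (y + y') =
    basisPairing (basis k) x y + basisPairing (basis k) x y' := by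
  simp only [basisPairing, map_add, Finsupp.add_apply, mul_add, Finsupp.sum_add]

theorem pairing_smul_right (n : ℤ) (x y : K0 k C) : basisPairing (basis k) x (n • y) =
    n * basisPairing (basis k) x y := by
  simp only [basisPairing, map_smul, Finsupp.smul_apply, smul_eq_mul, Finsupp.mul_sum]
  exact Finsupp.sum_congr fun _ _ => by ring

theorem pairing_basis_left (i : SimpleClass C) (y : K0 k C) :
    basisPairing (basis k) (basis k i) y = (basis k).repr y i := by
  simp [basisPairing]

theorem pairing_basis_right (i : SimpleClass C) (x : K0 k C) :
    basisPairing (basis k) x (basis k i) = (basis k).repr x i := by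
  classical
  have := hC.finite_simpleClass
  cases nonempty_fintype (SimpleClass C)
  simp [basisPairing, Finsupp.sum_fintype, Finsupp.single_apply]

theorem star_basis (σ : SimpleClass C → SimpleClass C) (i : SimpleClass C) :
    basisStar (basis k) σ (basis k i) = basis k (σ i) := by
  rw [basisStar, Module.Basis.constr_basis]

theorem pairing_mul_left (x y z : K0 k C) : basisPairing (basis k) (x * y) z =
    basisPairing (basis k) x (z * basisStar (basis k) (dual k) y) := by
  induction x using basis_induction k with
  | zero => simp [basisPairing]
  | add x x' hx hx' =>
    simp only [add_mul, mul_add, map_add, pairing_add_left, pairing_add_right, hx, hx']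
  | smul n x hx =>
    simp only [smul_mul_assoc, mul_smul_comm, map_smul, pairing_smul_left, pairing_smul_right, hx]
  | basis i =>
  induction y using basis_induction k with
  | zero => simp [basisPairing]
  | add x x' hx hx' =>
    simp only [add_mul, mul_add, map_add, pairing_add_left, pairing_add_right, hx, hx']
  | smul n x hx =>
    simp only [smul_mul_assoc, mul_smul_comm, map_smul, pairing_smul_left, pairing_smul_right, hx]
  | basis j =>
  induction z using basis_induction k with
  | zero => simp [basisPairing]
  | add x x' hx hx' =>
    simp only [add_mul, mul_add, map_add, pairing_add_left, pairing_add_right, hx, hx']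
  | smul n x hx =>
    simp only [smul_mul_assoc, mul_smul_comm, map_smul, pairing_smul_left, pairing_smul_right, hx]
  | basis l =>
  rw [star_basis, pairing_basis_left, pairing_basis_right, repr_mul_eq_left]

theorem pairing_mul_right (x y z : K0 k C) : basisPairing (basis k) (x * y) z =
    basisPairing (basis k) y (basisStar (basis k) (dual k) x * z) := by
  induction x using basis_induction k with
  | zero => simp [basisPairing]
  | add x x' hx hx' =>
    simp only [add_mul, mul_add, map_add, pairing_add_left, pairing_add_right, hx, hx']
  | smul n x hx =>
    simp only [smul_mul_assoc, mul_smul_comm, map_smul, pairing_smul_left, pairing_smul_right, hx]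
  | basis i =>
  induction y using basis_induction k with
  | zero => simp [basisPairing]
  | add x x' hx hx' =>
    simp only [add_mul, mul_add, map_add, pairing_add_left, pairing_add_right, hx, hx']
  | smul n x hx =>
    simp only [smul_mul_assoc, mul_smul_comm, map_smul, pairing_smul_left, pairing_smul_right, hx]
  | basis j =>
  induction z using basis_induction k with
  | zero => simp [basisPairing]
  | add x x' hx hx' =>
    simp only [add_mul, mul_add, map_add, pairing_add_left, pairing_add_right, hx, hx']
  | smul n x hx =>
    simp only [smul_mul_assoc, mul_smul_comm, map_smul, pairing_smul_left, pairing_smul_right, hx]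
  | basis l =>
  rw [star_basis, pairing_basis_left, pairing_basis_right, repr_mul_eq_right]

/-- The Grothendieck ring of a fusion category is a based ring. -/
noncomputable def basedRing : BasedRing (SimpleClass C) (K0 k C) where
  finite := hC.finite_simpleClass
  basis := basis k
  repr_mul_nonneg i j l := by
    rw [basis_mul_basis, basis_repr_cls]
    exact Nat.cast_nonneg _
  unit := haveI := hC.simple_unit; SimpleClass.of (𝟙_ C)
  basis_unit := haveI := hC.simple_unit; (cls_simple k (𝟙_ C)).symm
  dual := dual k
  dual_dual := dual_dual k
  pairing_mul_left x y z := pairing_mul_left k x y z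
  pairing_mul_right x y z := pairing_mul_right k x y z

end

end K0

/-! ## The universal grading group and tensor automorphisms of the identity functor -/

/-- The universal grading group `U(C) = U(K₀(C))` of a fusion category `C`. -/
abbrev UniversalGradingGroup (k : Type*) [Field k] [IsAlgClosed k] (C : Type*) [Category* C]
    [Abelian C] [Linear k C] [MonoidalCategory C] [MonoidalPreadditive C] [MonoidalLinear k C]
    [RigidCategory C] [IsFusionCategory k C] : Type _ :=
  (K0.basedRing k (C := C)).UniversalGradingGroup

end FusionCategory

/-- The group `Aut_⊗(id_C)` of tensor automorphisms of the identity functor of `C`, i.e. of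
monoidal natural automorphisms of `id_C`. -/
def TensorAutId (C : Type*) [Category* C] [MonoidalCategory C] : Subgroup (Aut (𝟭 C)) where
  carrier := {Φ | NatTrans.IsMonoidal Φ.hom}
  mul_mem' {Φ Ψ} hΦ hΨ := by
    have : NatTrans.IsMonoidal Φ.hom := hΦ
    have : NatTrans.IsMonoidal Ψ.hom := hΨ
    exact NatTrans.IsMonoidal.comp Ψ.hom Φ.hom
  one_mem' := NatTrans.IsMonoidal.id
  inv_mem' {Φ} hΦ := by
    let e : 𝟭 C ≅ 𝟭 C := Φ
    have : NatTrans.IsMonoidal e.hom := hΦ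
    exact (inferInstance : NatTrans.IsMonoidal e.inv)

/-!
Both sides are described by the same data, the families of nonzero scalars `c i`, indexed by the
isomorphism classes of simple objects, with `c l = c i * c j` whenever `X_l` is contained in
`X_i ⊗ X_j`.

* A natural automorphism of the identity functor acts on each simple object by a scalar, by
  Schur's lemma. Conversely, every family of scalars comes from a unique natural endomorphism
  (`FusionCategory.scalarNatTrans`), since by semisimplicity the identity of each object is a sum of
  morphisms which factor through simple objects (`FusionCategory.exists_id_eq_sum`). It is
  compatible with the tensor product exactly when the family is multiplicative in the above sense:
  both `Φ_{X ⊗ Y}` and `Φ_X ⊗ Φ_Y` are determined by their restrictions to the simple constituents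
  of `X_i ⊗ X_j`, where they are multiplication by `c l` and by `c i * c j`.
* A multiplicative family is constant on the components of the universal grading: it is trivial on
  the unit, hence on all constituents of `X_p X_p^*`, and therefore multiplying by such constituents
  does not change its value. So multiplicative families are the same as characters of the
  universal grading group (`BasedRing.exists_hom_comp_eq`), and these are the characters of its
  abelianization since `kˣ` is commutative.
-/

open CategoryTheory CategoryTheory.Limits CategoryTheory.MonoidalCategory

/-! ### Characters of the universal grading group -/

namespace BasedRing

variable {ι R M : Type*} [Ring R] (B : BasedRing ι R)

/-- A multiplicative function on the basic elements is constant on the components of the universal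
grading. -/
theorem eq_of_linked [Group M] {c : ι → M}
    (hc : ∀ i j l, B.Cont i j l → c l = c i * c j) {i j : ι} (h : B.Linked i j) : c i = c j := by
  have hunit : c B.unit = 1 := by
    have := hc B.unit B.unit B.unit (B.cont_unit_left.2 rfl)
    exact mul_eq_left.1 this.symm
  induction h with
  | refl => rfl
  | tail _ h ih =>
    obtain ⟨p, m, h1, h2⟩ := h
    rw [ih, hc _ _ _ h2, hc _ _ _ h1, ← hc _ _ _ (B.cont_mul_dual p), hunit, one_mul]

/-- A multiplicative function on the basic elements is a homomorphism on the universal grading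
group. -/
theorem exists_hom_comp_eq [Group M] {c : ι → M}
    (hc : ∀ i j l, B.Cont i j l → c l = c i * c j) :
    ∃ χ : B.UniversalGradingGroup →* M, ∀ i, χ (B.comp i) = c i := by
  choose r hr using B.exists_comp
  have key : ∀ i, c (r (B.comp i)) = c i := fun i =>
    (B.eq_of_linked hc (B.comp_eq_comp.1 (hr (B.comp i)))).symm
  refine ⟨MonoidHom.mk' (fun a => c (r a)) fun a b => ?_, key⟩
  obtain ⟨l, hl⟩ := B.exists_cont (r a) (r b)
  have h := B.comp_mul_comp hl
  rw [hr, hr] at h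
  rw [h, key, hc _ _ _ hl]

end BasedRing

namespace FusionCategory

theorem smul_tensorHom_smul {k C : Type*} [Field k] [Category* C] [Preadditive C] [Linear k C]
    [MonoidalCategory C] [MonoidalPreadditive C] [MonoidalLinear k C] {X X' Y Y' : C} (a b : k)
    (f : X ⟶ X') (g : Y ⟶ Y') : (a • f) ⊗ₘ (b • g) = (a * b) • (f ⊗ₘ g) := by
  simp [MonoidalCategory.tensorHom_def, smul_smul, mul_comm]

theorem isMonoidal_iff {C : Type*} [Category* C] [MonoidalCategory C] (Φ : 𝟭 C ⟶ 𝟭 C) :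
    NatTrans.IsMonoidal Φ ↔
      Φ.app (𝟙_ C) = 𝟙 (𝟙_ C) ∧ ∀ X Y : C, Φ.app (X ⊗ Y) = Φ.app X ⊗ₘ Φ.app Y := by
  constructor
  · intro h
    exact ⟨by simpa using h.unit, fun X Y => by simpa using h.tensor X Y⟩
  · rintro ⟨h1, h2⟩
    exact ⟨by simpa using h1, fun X Y => by simpa using h2 X Y⟩

section

variable (k : Type*) [Field k] {C : Type*} [Category* C] [Abelian C] [Linear k C]
  [MonoidalCategory C] [MonoidalPreadditive C] [MonoidalLinear k C] [RigidCategory C]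

/-! ### Detecting morphisms on simple objects -/

/-- The identity of every object is a sum of morphisms which factor through simple objects. -/
theorem exists_id_eq_sum (hC : IsFusionCategory k C) (X : C) :
    ∃ (n : ℕ) (i : Fin n → SimpleClass C) (p : ∀ a, X ⟶ (i a).rep) (s : ∀ a, (i a).rep ⟶ X),
      𝟙 X = ∑ a, p a ≫ s a := by
  have := Abelian.hasFiniteBiproducts (C := C)
  obtain ⟨n, S, hS, ⟨e⟩⟩ := hC.semisimple X
  have f : ∀ a, ∃ i : SimpleClass C, Nonempty (i.rep ≅ S a) := fun a =>
    have := hS a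
    ⟨_, SimpleClass.rep_of (S a)⟩
  choose i f using f
  refine ⟨n, i, fun a => e.hom ≫ biproduct.π S a ≫ (f a).some.inv,
    fun a => (f a).some.hom ≫ biproduct.ι S a ≫ e.inv, ?_⟩
  simp only [Category.assoc, Iso.inv_hom_id_assoc]
  rw [← Preadditive.comp_sum]
  simp only [← Category.assoc (biproduct.π S _)]
  rw [← Preadditive.sum_comp, biproduct.total]
  simp

/-- Morphisms are determined by their restrictions along morphisms from simple objects. -/
theorem hom_ext_simple (hC : IsFusionCategory k C) {X Y : C} {g h : X ⟶ Y}
    (H : ∀ (i : SimpleClass C) (s : i.rep ⟶ X), s ≫ g = s ≫ h) : g = h := by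
  obtain ⟨n, i, p, s, hid⟩ := exists_id_eq_sum k hC X
  rw [← Category.id_comp g, ← Category.id_comp h, hid, Preadditive.sum_comp, Preadditive.sum_comp]
  simp only [Category.assoc, H]

/-- Morphisms from `X ⊗ Y` are determined by their restrictions along tensor products of morphisms
from simple objects. -/
theorem tensor_hom_ext_simple (hC : IsFusionCategory k C) {X Y Z : C} {g h : X ⊗ Y ⟶ Z}
    (H : ∀ (i j : SimpleClass C) (s : i.rep ⟶ X) (t : j.rep ⟶ Y),
      (s ⊗ₘ t) ≫ g = (s ⊗ₘ t) ≫ h) : g = h := by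
  obtain ⟨n, i, p, s, hX⟩ := exists_id_eq_sum k hC X
  obtain ⟨m, j, q, t, hY⟩ := exists_id_eq_sum k hC Y
  have hid : 𝟙 (X ⊗ Y) = ∑ a, ∑ b, (p a ⊗ₘ q b) ≫ (s a ⊗ₘ t b) := by
    rw [← id_tensorHom_id, hX, hY, sum_tensor]
    simp only [tensor_sum, tensorHom_comp_tensorHom]
  rw [← Category.id_comp g, ← Category.id_comp h, hid]
  simp only [Preadditive.sum_comp, Category.assoc, H]

end

section

variable (k : Type*) [Field k] {C : Type*} [Category* C] [Abelian C] [Linear k C]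
  [MonoidalCategory C] [MonoidalPreadditive C] [MonoidalLinear k C] [RigidCategory C]
  [hC : IsFusionCategory k C]

/-! ### Natural automorphisms of the identity functor -/

/-- The endomorphism of `X` which is multiplication by `c i` on the isotypic component of each
simple object `X_i`. -/
theorem exists_comp_eq_smul (c : SimpleClass C → k) (X : C) :
    ∃ g : X ⟶ X, ∀ (i : SimpleClass C) (s : i.rep ⟶ X), s ≫ g = c i • s := by
  obtain ⟨n, i, p, s, hid⟩ := exists_id_eq_sum k hC X
  refine ⟨∑ a, c (i a) • p a ≫ s a, fun j f => ?_⟩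
  conv_rhs => rw [← Category.comp_id f, hid]
  rw [Preadditive.comp_sum, Preadditive.comp_sum, Finset.smul_sum]
  refine Finset.sum_congr rfl fun a _ => ?_
  rw [Linear.comp_smul, ← Category.assoc]
  by_cases h : f ≫ p a = 0
  · simp [h]
  -- By Schur's lemma, a nonzero morphism between simple objects is an isomorphism.
  · have := isIso_of_hom_simple h
    have hji : j = i a := SimpleClass.rep_iso_iff.1 ⟨asIso (f ≫ p a)⟩
    rw [congrArg c hji, Category.assoc]

/-- The natural endomorphism of the identity functor which is multiplication by `c i` on each simple
object `X_i`. -/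
noncomputable def scalarNatTrans (c : SimpleClass C → k) : 𝟭 C ⟶ 𝟭 C where
  app X := (exists_comp_eq_smul k c X).choose
  naturality X Y f := hom_ext_simple k hC fun i s => by
    have hX := (exists_comp_eq_smul k c X).choose_spec i s
    have hY := (exists_comp_eq_smul k c Y).choose_spec i (s ≫ f)
    dsimp only [Functor.id_map, Functor.id_obj]
    rw [← Category.assoc, hY, ← Category.assoc, hX, Linear.smul_comp]

theorem comp_scalarNatTrans_app (c : SimpleClass C → k) {X : C} {i : SimpleClass C}
    (s : i.rep ⟶ X) : s ≫ (scalarNatTrans k c).app X = c i • s :=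
  (exists_comp_eq_smul k c X).choose_spec i s

theorem scalarNatTrans_comp (c d : SimpleClass C → k) :
    scalarNatTrans k c ≫ scalarNatTrans k d = scalarNatTrans k (c * d) := by
  apply NatTrans.ext
  funext X
  refine hom_ext_simple k hC fun i s => ?_
  have h1 := comp_scalarNatTrans_app k c s
  have h2 := comp_scalarNatTrans_app k d s
  have h3 := comp_scalarNatTrans_app k (c * d) s
  dsimp only [Functor.id_obj, NatTrans.comp_app] at h1 h2 h3 ⊢
  rw [← Category.assoc, h1, Linear.smul_comp, h2, h3, smul_smul, Pi.mul_apply]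

theorem scalarNatTrans_one : scalarNatTrans k (1 : SimpleClass C → k) = 𝟙 (𝟭 C) := by
  apply NatTrans.ext
  funext X
  refine hom_ext_simple k hC fun i s => (comp_scalarNatTrans_app k 1 s).trans ?_
  simp

/-- The natural automorphism of the identity functor which is multiplication by `c i` on each simple
object `X_i`. -/
noncomputable def scalarAut : (SimpleClass C → kˣ) →* Aut (𝟭 C) where
  toFun c :=
    { hom := scalarNatTrans k fun i => (c i : k)
      inv := scalarNatTrans k fun i => ((c i)⁻¹ : kˣ)
      hom_inv_id := by
        rw [scalarNatTrans_comp, ← scalarNatTrans_one k]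
        exact congrArg _ (funext fun i => by simp)
      inv_hom_id := by
        rw [scalarNatTrans_comp, ← scalarNatTrans_one k]
        exact congrArg _ (funext fun i => by simp) }
  map_one' := Aut.ext (scalarNatTrans_one k)
  map_mul' c d := Aut.ext (by
    -- The product of `Aut` is composition in the opposite order.
    refine Eq.trans ?_ (scalarNatTrans_comp k _ _).symm
    exact congrArg (scalarNatTrans k) (funext fun i => mul_comm (c i : k) (d i)))

theorem scalarAut_hom (c : SimpleClass C → kˣ) :
    (scalarAut k c).hom = scalarNatTrans k fun i => (c i : k) := rfl

theorem scalarAut_injective : Function.Injective (scalarAut k (C := C)) := by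
  intro c d h
  ext i
  have hc := comp_scalarNatTrans_app k (fun i => (c i : k)) (𝟙 i.rep)
  rw [← scalarAut_hom, h, scalarAut_hom, comp_scalarNatTrans_app] at hc
  exact (smul_left_injective k (id_nonzero i.rep) hc).symm

end

section

variable (k : Type*) [Field k] [IsAlgClosed k] {C : Type*} [Category* C] [Abelian C] [Linear k C]
  [MonoidalCategory C] [MonoidalPreadditive C] [MonoidalLinear k C] [RigidCategory C]
  [hC : IsFusionCategory k C]

/-! ### Multiplicative families of scalars and monoidal automorphisms -/

/-- `X_l` is contained in `X_i X_j` if and only if there is a nonzero morphism from `X_l` to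
`X_i ⊗ X_j`. -/
theorem cont_iff {i j l : SimpleClass C} :
    (K0.basedRing k).Cont i j l ↔ ∃ f : l.rep ⟶ i.rep ⊗ j.rep, f ≠ 0 := by
  have := hC.finiteDimensional_hom
  have h : (K0.basedRing k).Cont i j l ↔ Module.finrank k (l.rep ⟶ i.rep ⊗ j.rep) ≠ 0 := by
    change (K0.basis k).repr (K0.basis k i * K0.basis k j) l ≠ 0 ↔ _
    rw [K0.basis_mul_basis, K0.basis_repr_cls, Nat.cast_ne_zero]
  rw [h, ← Nat.pos_iff_ne_zero, Module.finrank_pos_iff_exists_ne_zero]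

/-- The natural endomorphism given by a multiplicative family of scalars is monoidal. -/
theorem isMonoidal_scalarNatTrans {c : SimpleClass C → k} (hunit : c (K0.basedRing k).unit = 1)
    (hc : ∀ i j l, (K0.basedRing k).Cont i j l → c l = c i * c j) :
    NatTrans.IsMonoidal (scalarNatTrans k c) := by
  have := hC.simple_unit
  refine (isMonoidal_iff _).2 ⟨?_, fun X Y => tensor_hom_ext_simple k hC fun i j s t => ?_⟩
  · obtain ⟨e⟩ := SimpleClass.rep_of (𝟙_ C)
    have h := comp_scalarNatTrans_app k c e.hom
    rw [show c (SimpleClass.of (𝟙_ C)) = 1 from hunit, one_smul] at h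
    exact (cancel_epi e.hom).1 (h.trans (Category.comp_id _).symm)
  · have hs := comp_scalarNatTrans_app k c s
    have ht := comp_scalarNatTrans_app k c t
    have hst : (scalarNatTrans k c).app (i.rep ⊗ j.rep) = (c i * c j) • 𝟙 (i.rep ⊗ j.rep) := by
      refine hom_ext_simple k hC fun l f => (comp_scalarNatTrans_app k c f).trans ?_
      by_cases hf : f = 0
      · simp [hf]
      · rw [hc i j l ((cont_iff k).2 ⟨f, hf⟩)]
        simp
    have hnat := (scalarNatTrans k c).naturality (s ⊗ₘ t)
    dsimp only [Functor.id_map, Functor.id_obj] at hnat hs ht hst ⊢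
    rw [hnat, hst, tensorHom_comp_tensorHom, hs, ht, smul_tensorHom_smul]
    simp

/-- By Schur's lemma, a natural automorphism of the identity functor is given by a family of
scalars. -/
theorem scalarAut_surjective : Function.Surjective (scalarAut k (C := C)) := by
  intro Φ
  have := hC.finiteDimensional_hom
  have hex : ∀ i : SimpleClass C, ∃ u : kˣ, (u : k) • 𝟙 i.rep = Φ.hom.app i.rep := by
    intro i
    obtain ⟨u, hu⟩ := endomorphism_simple_eq_smul_id k (X := i.rep) (Φ.hom.app i.rep)
    have hu0 : u ≠ 0 := by
      rintro rfl
      rw [zero_smul] at hu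
      have h := Φ.hom_inv_id_app i.rep
      rw [← hu] at h
      exact id_nonzero i.rep (h.symm.trans zero_comp)
    exact ⟨Units.mk0 u hu0, hu⟩
  choose c hc using hex
  refine ⟨c, Aut.ext ?_⟩
  apply NatTrans.ext
  funext X
  refine hom_ext_simple k hC fun i s => (comp_scalarNatTrans_app k _ s).trans ?_
  have hnat := Φ.hom.naturality s
  dsimp only [Functor.id_map, Functor.id_obj] at hnat hc ⊢
  rw [hnat, ← hc, Linear.smul_comp, Category.id_comp]

/-- If the natural automorphism given by a family of scalars is monoidal, then the family is
multiplicative. -/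
theorem eq_mul_of_isMonoidal {c : SimpleClass C → kˣ} (h : scalarAut k c ∈ TensorAutId C)
    {i j l : SimpleClass C} (hl : (K0.basedRing k).Cont i j l) : c l = c i * c j := by
  obtain ⟨f, hf⟩ := (cont_iff k).1 hl
  have htensor := ((isMonoidal_iff _).1 h).2 i.rep j.rep
  have hfl := comp_scalarNatTrans_app k (fun i => (c i : k)) f
  have hi := comp_scalarNatTrans_app k (fun i => (c i : k)) (𝟙 i.rep)
  have hj := comp_scalarNatTrans_app k (fun i => (c i : k)) (𝟙 j.rep)
  rw [scalarAut_hom] at htensor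
  dsimp only [Functor.id_obj] at htensor hfl hi hj
  rw [Category.id_comp] at hi hj
  rw [htensor, hi, hj, smul_tensorHom_smul, id_tensorHom_id, Linear.comp_smul,
    Category.comp_id] at hfl
  exact Units.ext (smul_left_injective k hf hfl).symm

/-- The tensor automorphism of the identity functor given by a character of the universal grading
group. -/
noncomputable def gradingAut : (UniversalGradingGroup k C →* kˣ) →* TensorAutId C where
  toFun χ := ⟨scalarAut k fun i => χ ((K0.basedRing k).comp i), by
    refine isMonoidal_scalarNatTrans k ?_ fun i j l h => ?_
    · simp only [BasedRing.comp_unit, map_one, Units.val_one]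
    · simp only [← BasedRing.comp_mul_comp _ h, map_mul, Units.val_mul]⟩
  map_one' := Subtype.ext (map_one (scalarAut k))
  map_mul' χ ψ := Subtype.ext (map_mul (scalarAut k) _ _)

theorem gradingAut_bijective : Function.Bijective (gradingAut k (C := C)) := by
  constructor
  · intro χ ψ h
    have h' := scalarAut_injective k (congrArg Subtype.val h)
    ext a : 1
    obtain ⟨i, rfl⟩ := (K0.basedRing k).exists_comp a
    exact congrFun h' i
  · rintro ⟨Φ, hΦ⟩
    obtain ⟨c, rfl⟩ := scalarAut_surjective k Φ
    obtain ⟨χ, hχ⟩ := (K0.basedRing k).exists_hom_comp_eq fun i j l => eq_mul_of_isMonoidal k hΦ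
    exact ⟨χ, Subtype.ext (congrArg (scalarAut k) (funext hχ))⟩

end

end FusionCategory

theorem proposition3p7 (k : Type*) [Field k] [IsAlgClosed k] [CharZero k]
    (C : Type*) [Category* C] [Abelian C] [Linear k C] [MonoidalCategory C]
    [MonoidalPreadditive C] [MonoidalLinear k C] [RigidCategory C] [IsFusionCategory k C] :
    Nonempty ((Abelianization (UniversalGradingGroup k C) →* kˣ) ≃* TensorAutId C) := by
  let lift : (UniversalGradingGroup k C →* kˣ) ≃*
      (Abelianization (UniversalGradingGroup k C) →* kˣ) :=
    { Abelianization.lift with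
      map_mul' := fun χ ψ => by
        ext a
        simp }
  exact ⟨lift.symm.trans (MulEquiv.ofBijective _ (FusionCategory.gradingAut_bijective k))⟩
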